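/- **Setting.** Let $\Gamma\subset\mathbb Z^\nu$ carry the $\ell^1$-distance $d(x,y)=\sum_j|x_j-y_j|$, and put a quantum spin $\mathbb C^d$ at each site. For finite $X\subset\Gamma$ let $\mathcal A_X=\bigotimes_{x\in X}M_d(\mathbb C)=\mathcal B(\bigotimes_{x\in X}\mathbb C^d)$, with the operator norm, and regard $\mathcal A_X\subset\mathcal A_\Lambda$ for $X\subset\Lambda$ through $A\mapsto A\otimes 1_{\Lambda\setminus X}$. Let $\Phi$ be an interaction, assigning to each finite $X\subset\Gamma$ an element $\Phi(X)=\Phi(X)^*\in\mathcal A_X$, such that $\Phi(X)=0$ whenever $\operatorname{diam}(X)=\max_{x,y\in X}d(x,y)>\mathfrak r_\Phi$, and $\mathfrak j_\Phi:=\sup_{x\in\Gamma}\sum_{X\ni x}\|\Phi(X)\|<\infty$ (the sum is over finite $X\subset\Gamma$). Let $\Lambda\subset\Gamma$ be finite, $H_\Lambda:=\sum_{X\subset\Lambda}\Phi(X)$, and assume $H_\Lambda\ge 0$. Let $L\subset\Lambda$, $L^c:=\Lambda\setminus L$, and let $\partial L\subset\Lambda$ be any region with $$\partial L\supset\{x\in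 L: d(x,L^c)\le\mathfrak r_\Phi\}\cup\{y\in L^c: d(y,L)\le\mathfrak r_\Phi\}.$$ Put $$H_{\partial L}:=\sum_{Z\subset\partial L}\Phi(Z),\qquad H'_K:=\sum_{Z\subset K,\ Z\not\subset\partial L}\Phi(Z)\quad (K=L,\,L^c),$$ so that $H_\Lambda=H'_L+H_{\partial L}+H'_{L^c}$. Write $E^A(I)$ for the spectral projection of a self-adjoint $A$ on $I\subset\mathbb R$. For $M>\|H_{\partial L}\|$ define, with $H':=H'_L+H'_{L^c}$, $$\bar H_\Lambda:=H_{\partial L}+H'E^{H'}(-M,M)+M\,E^{H'}[M,\infty).$$ **Theorem.** Let $$N_\Phi:=\sup_{x\in\Gamma}|\{y\in\Gamma: d(x,y)\le\mathfrak r_\Phi\}|,\qquad \lambda:=\frac{1}{4\,\mathfrak j_\Phi\,(N_\Phi+|\partial L|)}$$ (with $\lambda:=0$ in the degenerate case where the denominator vanishes), and $$\delta(p,q):=2\sqrt2\,(M+5\|H_{\partial L}\|+q)\,e^{-\lambda(M-2p-18\|H_{\partial L}\|)},$$ $$\eta(\epsilon,\delta):=2\sqrt2\,(M+\|H_{\partial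 L}\|+\delta)\,e^{-\lambda(M-2\epsilon-10\|H_{\partial L}\|)}.$$ Then $N_\Phi<\infty$, and: (i) for all real $q>p\ge-2\|H_{\partial L}\|$, $$\Big\|\big(I-E^{H_\Lambda}(-\infty,q)\big)\,E^{\bar H_\Lambda}(-\infty,p]\Big\|\le\frac{p+2\|H_{\partial L}\|+\delta(p,q)}{q+2\|H_{\partial L}\|};$$ (ii) for all real $\delta>\epsilon\ge 0$, $$\Big\|\big(I-E^{H_\Lambda}(-\delta,\delta)\big)\,E^{\bar H_\Lambda}[-\epsilon,\epsilon]\Big\|\le\frac{\epsilon+\eta(\epsilon,\delta)}{\delta}.$$ In particular the bounds involve $\Lambda$ only through $\|H_{\partial L}\|$ and $|\partial L|$, not through $|\Lambda|$. -/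

import Mathlib

open scoped ENNReal ComplexOrder Matrix.Norms.L2Operator

/-! Matrices carry the operator norm of the Euclidean (Hilbert) norm: this is what
`Matrix.Norms.L2Operator` provides. -/

namespace SpinSystem

noncomputable section

variable {ν : ℕ} {Γ : Set (Fin ν → ℤ)} {d : ℕ}

/-- The `ℓ¹`-distance on `ℤ^ν`. -/
def dist1 (x y : Fin ν → ℤ) : ℕ := ∑ j, (x j - y j).natAbs

/-- The diameter `max_{x, y ∈ X} d(x, y)` of a finite region (`0` for the empty region). -/
def diam1 (X : Finset Γ) : ℕ :=
  X.sup fun x => X.sup fun y => dist1 (x : Fin ν → ℤ) y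

/-- The algebra `𝒜_X = ⨂_{x ∈ X} M_d(ℂ) = 𝓑(⨂_{x ∈ X} ℂ^d)`, written as matrices in the product
basis of `⨂_{x ∈ X} ℂ^d`, which is indexed by the configurations `X → Fin d`. -/
abbrev Obs (d : ℕ) (X : Finset Γ) : Type := Matrix (X → Fin d) (X → Fin d) ℂ

/-- The inclusion `𝒜_X → 𝒜_Λ`, `A ↦ A ⊗ 1_{Λ \ X}`, in the product bases. -/
def embed {X Λ : Finset Γ} (h : X ⊆ Λ) (A : Obs d X) : Obs d Λ :=
  Matrix.of fun σ τ =>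
    if ∀ x : Λ, (x : Γ) ∉ X → σ x = τ x then
      A (fun x => σ ⟨x, h x.2⟩) (fun x => τ ⟨x, h x.2⟩)
    else 0

/-- An interaction `X ↦ Φ(X) = Φ(X)^* ∈ 𝒜_X` on the finite regions `X` of `Γ`. -/
structure Interaction (Γ : Set (Fin ν → ℤ)) (d : ℕ) where
  /-- the interaction term of a region -/
  term : (X : Finset Γ) → Obs d X
  isHermitian : ∀ X, (term X).IsHermitian

namespace Interaction

/-- Finite range: `Φ(X) = 0` whenever `diam X > r`. -/
def HasRange (Φ : Interaction Γ d) (r : ℝ) : Prop :=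
  ∀ X : Finset Γ, r < (diam1 X : ℝ) → Φ.term X = 0

/-- The strength `sup_{x ∈ Γ} ∑_{X ∋ x} ‖Φ(X)‖`, the sum being over all finite regions of `Γ`
that contain `x`. -/
def strength (Φ : Interaction Γ d) : ℝ≥0∞ :=
  ⨆ x : Γ, ∑' X : {X : Finset Γ // x ∈ X}, ENNReal.ofReal ‖Φ.term X.1‖

/-- `Φ(Z)` as an element of `𝒜_Λ`. It is used for `Z ⊆ Λ` only. -/
def termIn (Φ : Interaction Γ d) (Λ Z : Finset Γ) : Obs d Λ :=
  if h : Z ⊆ Λ then embed h (Φ.term Z) else 0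

/-- The Hamiltonian `H_Λ = ∑_{X ⊆ Λ} Φ(X)`. -/
def ham (Φ : Interaction Γ d) (Λ : Finset Γ) : Obs d Λ :=
  ∑ Z ∈ Λ.powerset, Φ.termIn Λ Z

/-- `H_{∂L} = ∑_{Z ⊆ ∂L} Φ(Z)` in `𝒜_Λ`; here `B` is the region `∂L`. -/
def hamBoundary (Φ : Interaction Γ d) (Λ B : Finset Γ) : Obs d Λ :=
  ∑ Z ∈ B.powerset, Φ.termIn Λ Z

/-- `H'_K = ∑_{Z ⊆ K, Z ∩ (∂L)^c ≠ ∅} Φ(Z)` in `𝒜_Λ`, for `K = L` and `K = L^c`; here `B` is the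
region `∂L`. -/
def hamBulk (Φ : Interaction Γ d) (Λ B K : Finset Γ) : Obs d Λ :=
  ∑ Z ∈ K.powerset with (Z \ B).Nonempty, Φ.termIn Λ Z

/-- `H'_L + H'_{L^c}`, with `L^c = Λ \ L` and `B = ∂L`. -/
def hamDecoupled (Φ : Interaction Γ d) (Λ L B : Finset Γ) : Obs d Λ :=
  Φ.hamBulk Λ B L + Φ.hamBulk Λ B (Λ \ L)

end Interaction

/-- `B` is an admissible choice of the region `∂L ⊆ Λ`: it contains the points of `L` at distance
`≤ r` from `L^c = Λ \ L` and the points of `L^c` at distance `≤ r` from `L`. -/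
def IsBoundaryRegion (r : ℝ) (Λ L B : Finset Γ) : Prop :=
  B ⊆ Λ ∧
  (∀ x ∈ L, (∃ y ∈ Λ \ L, (dist1 (x : Fin ν → ℤ) y : ℝ) ≤ r) → x ∈ B) ∧
  (∀ y ∈ Λ \ L, (∃ x ∈ L, (dist1 (y : Fin ν → ℤ) x : ℝ) ≤ r) → y ∈ B)

/-- `N_Φ = sup_{x ∈ Γ} |{y ∈ Γ ; d(x, y) ≤ r}|`. -/
def ballNumber (Γ : Set (Fin ν → ℤ)) (r : ℝ) : ℕ∞ :=
  ⨆ x : Γ, Set.encard {y : Γ | (dist1 (x : Fin ν → ℤ) y : ℝ) ≤ r}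

/-- The spectral projection `E^A(I)` of a Hermitian matrix `A`, that is, `1_I(A)`; see
`specProj_eq_sum` for its expression through orthonormal eigenvectors. -/
def specProj {n : Type*} [Fintype n] [DecidableEq n] (A : Matrix n n ℂ) (I : Set ℝ) :
    Matrix n n ℂ :=
  cfc (I.indicator (1 : ℝ → ℝ)) A

open scoped Classical in
/-- `E^A(I) = ∑_{j ; ε_j ∈ I} |ψ_j⟩⟨ψ_j|`. -/
theorem specProj_eq_sum {n : Type*} [Fintype n] [DecidableEq n] {A : Matrix n n ℂ}
    (hA : A.IsHermitian) (I : Set ℝ) :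
    specProj A I = ∑ j with hA.eigenvalues j ∈ I,
      Matrix.vecMulVec (hA.eigenvectorBasis j).ofLp (star (hA.eigenvectorBasis j).ofLp) := by
  rw [specProj, hA.cfc_eq, Matrix.IsHermitian.cfc]
  ext a b
  simp [Matrix.mul_apply, Matrix.diagonal_apply, Matrix.sum_apply, Matrix.vecMulVec_apply,
    Finset.sum_filter, Set.indicator_apply, Unitary.conjStarAlgAut_apply, Matrix.star_apply]
  refine Finset.sum_congr rfl fun j _ => ?_
  split_ifs <;> simp

/-- The energy truncation `A E^A(-M, M) + M E^A[M, ∞)`. -/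
def truncate {n : Type*} [Fintype n] [DecidableEq n] (A : Matrix n n ℂ) (M : ℝ) : Matrix n n ℂ :=
  A * specProj A (Set.Ioo (-M) M) + M • specProj A (Set.Ici M)

/-- The energy-truncated Hamiltonian: `H_{∂L}` plus the truncation of `H'_L + H'_{L^c}` at `M`. -/
def Interaction.hamTrunc (Φ : Interaction Γ d) (Λ L B : Finset Γ) (M : ℝ) : Obs d Λ :=
  Φ.hamBoundary Λ B + truncate (Φ.hamDecoupled Λ L B) M

/-- `λ = 1 / (4 𝔧_Φ (N_Φ + |∂L|))`. -/
def decayRate (Φ : Interaction Γ d) (r : ℝ) (B : Finset Γ) : ℝ :=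
  1 / (4 * Φ.strength.toReal * (((ballNumber Γ r).toNat : ℝ) + (B.card : ℝ)))

/-- `δ(p, q)`, with `h = ‖H_{∂L}‖`. -/
def deltaErr (lam M h p q : ℝ) : ℝ :=
  2 * √2 * (M + 5 * h + q) * Real.exp (-lam * (M - 2 * p - 18 * h))

/-- `η(ε, δ)`, with `h = ‖H_{∂L}‖`. -/
def etaErr (lam M h ε δ : ℝ) : ℝ :=
  2 * √2 * (M + h + δ) * Real.exp (-lam * (M - 2 * ε - 10 * h))

end

end SpinSystem

/-!
Write `V = H_{∂L}`, `K = H'_L + H'_{L^c}`, `T = min(K, M)` and `h = ‖V‖`. By finite range,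
`H_Λ = V + K`, and `H_Λ ≥ 0` forces `K ≥ -h > -M`, so that `V + T` is the truncated Hamiltonian.

The heart of the matter is that a state of truncated energy at most `p` has an exponentially small
component in the range of `E^K[M, ∞)`. Repeated commutators of `K` with `V` grow at most like
`n! cⁿ`, with `c = 2 𝔧_Φ (N_Φ + |∂L|)`: a commutator with a local operator only sees the interaction
terms that touch its support, and each of them enlarges the support by at most `N_Φ` sites
(`norm_iterate_commutator_le`). Hence the imaginary-time evolution `e^{sK} V e^{-sK}` has norm at
most `2h` for `0 ≤ s ≤ λ = 1 / (2c)`. Cutting at the spectral projection of `K` at `M` turns this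
into the bound `3h` for `e^{sT} V e^{-sT}` (`norm_exp_conj_truncate_le`). By Grönwall's inequality
`‖e^{λT} e^{-λ(V + T)}‖ ≤ e^{3hλ}`, and since `T = M` on the range of `E^K[M, ∞)`,
`‖E^K[M, ∞) E^{V + T}(-∞, p]‖ ≤ e^{-λ(M - p - 3h)}` (`norm_specProj_Ici_mul_specProj_Iic_le`). This
is at most the exponential in `δ(p, q)` if `p ≥ -2h`, and at most the one in `η(ε, δ)` if
`p = ε ≥ 0`.

The theorem then follows from a Markov inequality (`norm_specProj_compl_mul_le`): `V + K` and
`V + T` agree on the range of `E^K(-∞, M)`, so that up to the exponentially small component the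
energy of the state with respect to `H_Λ` is its truncated energy.
-/

/-! ### Exponentials in Banach algebras -/

open NormedSpace in
/-- The expansion `e^H V e^{-H} = ∑ₙ (ad H)ⁿ(V) / n!`, which is the factorization
`e^{ad H} = e^{L_H} e^{-R_H}` for the commuting left and right multiplications by `H`. -/
theorem hasSum_exp_mul_mul_exp_neg {𝔸 : Type*} [NormedRing 𝔸] [NormedAlgebra ℝ 𝔸]
    [CompleteSpace 𝔸] (H V : 𝔸) :
    HasSum (fun n : ℕ => ((n.factorial : ℝ)⁻¹) • (fun X => H * X - X * H)^[n] V)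
      (exp H * V * exp (-H)) := by
  let L : 𝔸 →L[ℝ] 𝔸 := ContinuousLinearMap.mul ℝ 𝔸 H
  let R : 𝔸 →L[ℝ] 𝔸 := (ContinuousLinearMap.mul ℝ 𝔸).flip (-H)
  have hcomm : Commute L R := by
    ext X
    simp [L, R, mul_assoc]
  have hL : ∀ X, exp L X = exp H * X := by
    intro X
    have h1 := (exp_series_hasSum_exp' (𝕂 := ℝ) L).mapL (ContinuousLinearMap.apply ℝ 𝔸 X)
    have h2 := (exp_series_hasSum_exp' (𝕂 := ℝ) H).mul_right X
    refine h1.unique (h2.congr_fun ?_)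
    intro n
    have : ∀ n : ℕ, (L ^ n) X = H ^ n * X := by
      intro n
      induction n with
      | zero => simp
      | succ n ih => simp [pow_succ', ih, L, mul_assoc]
    simp [this]
  have hR : ∀ X, exp R X = X * exp (-H) := by
    intro X
    have h1 := (exp_series_hasSum_exp' (𝕂 := ℝ) R).mapL (ContinuousLinearMap.apply ℝ 𝔸 X)
    have h2 := (exp_series_hasSum_exp' (𝕂 := ℝ) (-H)).mul_left X
    refine h1.unique (h2.congr_fun ?_)
    intro n
    have : ∀ n : ℕ, (R ^ n) X = X * (-H) ^ n := by
      intro n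
      induction n with
      | zero => simp
      | succ n ih =>
        rw [pow_succ', pow_succ, mul_apply_eq_comp, ih, ← mul_assoc]
        rfl
    simp [this]
  have h := (exp_series_hasSum_exp' (𝕂 := ℝ) (L + R)).mapL (ContinuousLinearMap.apply ℝ 𝔸 V)
  rw [exp_add_of_commute_of_mem_ball (𝕂 := ℝ) hcomm (by simp [expSeries_radius_eq_top])
    (by simp [expSeries_radius_eq_top])] at h
  rw [ContinuousLinearMap.apply_apply, mul_apply_eq_comp, hL, hR, ← mul_assoc] at h
  refine h.congr_fun fun n => ?_
  have : ∀ n : ℕ, ((L + R) ^ n) V = (fun X => H * X - X * H)^[n] V := by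
    intro n
    induction n with
    | zero => simp
    | succ n ih =>
      rw [pow_succ', Function.iterate_succ_apply', ← ih]
      simp [L, R, sub_eq_add_neg]
  simp [this]

open NormedSpace in
/-- Commutators growing like `n! cⁿ` make the imaginary-time evolution converge geometrically, with
ratio `s c ≤ 1 / 2`. -/
theorem norm_exp_smul_mul_mul_exp_neg_le {𝔸 : Type*} [NormedRing 𝔸] [NormedAlgebra ℝ 𝔸]
    [CompleteSpace 𝔸] {H V : 𝔸} {c h s : ℝ} (hc : 0 ≤ c) (hs : 0 ≤ s) (hsc : s * c ≤ 1 / 2)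
    (hV : ∀ n : ℕ, ‖(fun X => H * X - X * H)^[n] V‖ ≤ h * (n.factorial * c ^ n)) :
    ‖exp (s • H) * V * exp (-(s • H))‖ ≤ 2 * h := by
  have hh : 0 ≤ h := by simpa using (norm_nonneg _).trans (hV 0)
  have hiter : ∀ n : ℕ, (fun X => (s • H) * X - X * (s • H))^[n] V
      = s ^ n • (fun X => H * X - X * H)^[n] V := by
    intro n
    induction n with
    | zero => simp
    | succ n ih =>
      rw [Function.iterate_succ_apply', Function.iterate_succ_apply', ih]
      simp only [pow_succ, mul_smul_comm, smul_mul_assoc, smul_sub, smul_smul, mul_comm s]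
  have hsum := hasSum_exp_mul_mul_exp_neg (s • H) V
  have hgeo : HasSum (fun n : ℕ => h * (1 / 2 : ℝ) ^ n) (h * 2) := hasSum_geometric_two.mul_left h
  rw [mul_comm, ← hsum.tsum_eq]
  refine tsum_of_norm_bounded hgeo fun n => ?_
  rw [hiter, smul_smul, norm_smul, Real.norm_of_nonneg (by positivity)]
  calc ((n.factorial : ℝ)⁻¹ * s ^ n) * ‖(fun X => H * X - X * H)^[n] V‖
      ≤ ((n.factorial : ℝ)⁻¹ * s ^ n) * (h * (n.factorial * c ^ n)) := by gcongr; exact hV n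
    _ = h * (s * c) ^ n := by
      rw [mul_pow]; field_simp
    _ ≤ h * (1 / 2) ^ n := by gcongr

open NormedSpace Set in
/-- Grönwall's inequality for `g(s) = e^{sT} e^{-s(V + T)}`, which solves
`g' = -(e^{sT} V e^{-sT}) g`, `g(0) = 1`. -/
theorem norm_exp_mul_exp_neg_le {𝔸 : Type*} [NormedRing 𝔸] [NormOneClass 𝔸] [NormedAlgebra ℝ 𝔸]
    [CompleteSpace 𝔸] {T V : 𝔸} {c lam : ℝ} (hlam : 0 ≤ lam)
    (hconj : ∀ s, 0 ≤ s → s ≤ lam → ‖exp (s • T) * V * exp (-(s • T))‖ ≤ c) :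
    ‖exp (lam • T) * exp (-(lam • (V + T)))‖ ≤ Real.exp (c * lam) := by
  set g : ℝ → 𝔸 := fun s => exp (s • T) * exp (s • -(V + T)) with hg
  have hder : ∀ s, HasDerivAt g (-((exp (s • T) * V * exp (-(s • T))) * g s)) s := by
    intro s
    have h1 := (hasDerivAt_exp_smul_const (𝕂 := ℝ) T s).mul
      (hasDerivAt_exp_smul_const' (𝕂 := ℝ) (-(V + T)) s)
    refine h1.congr_deriv ?_
    have h2 : exp (-(s • T)) * exp (s • T) = 1 := by
      rw [← exp_add_of_commute_of_mem_ball (𝕂 := ℝ) ((Commute.refl _).neg_left)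
        (by simp [expSeries_radius_eq_top]) (by simp [expSeries_radius_eq_top])]
      simp
    have h3 : exp (s • T) * V * exp (-(s • T)) * g s = exp (s • T) * V * exp (s • -(V + T)) := by
      rw [hg]
      calc _ = exp (s • T) * V * (exp (-(s • T)) * exp (s • T)) * exp (s • -(V + T)) := by
            simp only [mul_assoc]
        _ = _ := by rw [h2, mul_one]
    rw [h3]
    noncomm_ring
  have h := norm_le_gronwallBound_of_norm_deriv_right_le (f := g) (δ := 1) (K := c) (ε := 0)
    (a := 0) (b := lam) (fun s _ => (hder s).continuousAt.continuousWithinAt)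
    (fun s _ => (hder s).hasDerivWithinAt) (by simp [hg])
    (fun s hs => by
      rw [norm_neg, add_zero]
      refine (norm_mul_le _ _).trans ?_
      gcongr
      exact hconj s hs.1 hs.2.le) lam ⟨hlam, le_rfl⟩
  simpa [hg, gronwallBound_ε0, smul_neg] using h

namespace SpinSystem

/-! ### Local observables -/

section Lattice

variable {ν : ℕ} {Γ : Set (Fin ν → ℤ)} {d : ℕ}

/-- The configuration that agrees with `α` on `X` and with `σ` off `X`. -/
def patch {X Λ : Finset Γ} (σ : Λ → Fin d) (α : X → Fin d) : Λ → Fin d := fun x =>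
  if hx : (x : Γ) ∈ X then α ⟨x, hx⟩ else σ x

/-- The entries of `A ⊗ 1` vanish unless the two configurations agree off `X`, so the sum over the
intermediate configuration runs over its restriction to `X` only. -/
theorem embed_mul_apply {X Λ : Finset Γ} (h : X ⊆ Λ) (A : Obs d X) (B : Obs d Λ)
    (σ τ : Λ → Fin d) :
    (embed h A * B) σ τ = ∑ α : X → Fin d, A (fun x => σ ⟨x, h x.2⟩) α * B (patch σ α) τ := by
  rw [Matrix.mul_apply]
  symm
  refine Finset.sum_of_injOn (fun α => patch σ α) ?_ (fun _ _ => by simp) ?_ ?_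
  · intro α _ β _ hαβ
    ext x
    have := congrFun hαβ ⟨x, h x.2⟩
    simpa [patch] using congrArg Fin.val this
  · intro ρ _ hρ
    rw [embed, Matrix.of_apply, if_neg, zero_mul]
    intro hσ
    refine hρ ⟨fun x => ρ ⟨x, h x.2⟩, by simp, ?_⟩
    ext x
    by_cases hx : (x : Γ) ∈ X
    · simp [patch, hx]
    · simp [patch, hx, hσ x hx]
  · intro α _
    rw [embed, Matrix.of_apply, if_pos]
    · congr 2
      ext x
      simp [patch]
    · intro x hx
      simp [patch, hx]

theorem embed_mul {X Λ : Finset Γ} (h : X ⊆ Λ) (A B : Obs d X) :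
    embed h (A * B) = embed h A * embed h B := by
  ext σ τ
  rw [embed_mul_apply]
  have hoff : ∀ α : X → Fin d, (∀ x : Λ, (x : Γ) ∉ X → patch σ α x = τ x) ↔
      ∀ x : Λ, (x : Γ) ∉ X → σ x = τ x := fun α =>
    forall₂_congr fun x hx => by simp [patch, hx]
  have hon : ∀ α : X → Fin d, (fun x : X => patch σ α ⟨x, h x.2⟩) = α := fun α => by
    ext x; simp [patch]
  simp only [embed, Matrix.of_apply, hoff, hon]
  split_ifs <;> simp [Matrix.mul_apply]

theorem embed_conjTranspose {X Λ : Finset Γ} (h : X ⊆ Λ) (A : Obs d X) :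
    embed h (star A) = star (embed h A) := by
  ext σ τ
  simp only [embed, Matrix.star_apply, Matrix.of_apply]
  simp only [eq_comm]
  split_ifs <;> simp

/-- The inclusion `𝒜_X → 𝒜_Λ` as a `⋆`-homomorphism; it is bundled as a non-unital one, since this
suffices for it to be contractive. -/
def embedHom {X Λ : Finset Γ} (h : X ⊆ Λ) : Obs d X →⋆ₙₐ[ℂ] Obs d Λ where
  toFun := embed h
  map_smul' c A := by
    ext σ τ; simp [embed]
  map_zero' := by ext σ τ; simp [embed]
  map_add' A B := by
    ext σ τ; simp only [embed, Matrix.add_apply, Matrix.of_apply]; split_ifs <;> simp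
  map_mul' := embed_mul h
  map_star' := embed_conjTranspose h

theorem norm_embed_le {X Λ : Finset Γ} (h : X ⊆ Λ) (A : Obs d X) : ‖embed h A‖ ≤ ‖A‖ :=
  NonUnitalStarAlgHom.norm_apply_le (embedHom h) A

theorem embed_commute {X Y Λ : Finset Γ} (hX : X ⊆ Λ) (hY : Y ⊆ Λ) (hXY : Disjoint X Y)
    (A : Obs d X) (B : Obs d Y) : Commute (embed hX A) (embed hY B) := by
  have hd : ∀ x : Γ, x ∈ X → x ∉ Y := fun x hx hy => Finset.disjoint_left.1 hXY hx hy
  -- Both products have the entries of `A ⊗ B` on `X ∪ Y` and of the identity elsewhere.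
  have key : ∀ {X Y : Finset Γ} (hX : X ⊆ Λ) (hY : Y ⊆ Λ) (_ : ∀ x : Γ, x ∈ X → x ∉ Y)
      (A : Obs d X) (B : Obs d Y) (σ τ : Λ → Fin d), (embed hX A * embed hY B) σ τ =
      if ∀ x : Λ, (x : Γ) ∉ X → (x : Γ) ∉ Y → σ x = τ x then
        A (fun x => σ ⟨x, hX x.2⟩) (fun x => τ ⟨x, hX x.2⟩) *
          B (fun x => σ ⟨x, hY x.2⟩) (fun x => τ ⟨x, hY x.2⟩) else 0 := by
    intro X Y hX hY hd A B σ τ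
    rw [embed_mul_apply, Finset.sum_eq_single (fun x : X => τ ⟨x, hX x.2⟩)]
    · have h1 : (fun x : Y => patch σ (fun x : X => τ ⟨x, hX x.2⟩) ⟨x, hY x.2⟩) =
          fun x : Y => σ ⟨x, hY x.2⟩ := by
        ext x
        have : (x : Γ) ∉ X := fun hx => hd _ hx x.2
        simp [patch, this]
      have h2 : (∀ x : Λ, (x : Γ) ∉ Y → patch σ (fun x : X => τ ⟨x, hX x.2⟩) x = τ x) ↔
          ∀ x : Λ, (x : Γ) ∉ X → (x : Γ) ∉ Y → σ x = τ x := by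
        refine forall_congr' fun x => ?_
        by_cases hx : (x : Γ) ∈ X <;> simp [patch, hx]
      simp only [embed, Matrix.of_apply, h1, h2]
      split_ifs <;> simp
    · intro α _ hα
      rw [embed, Matrix.of_apply, if_neg, mul_zero]
      intro hall
      apply hα
      ext x
      have := hall ⟨x, hX x.2⟩ (hd _ x.2)
      simpa [patch] using congrArg Fin.val this
    · simp
  ext σ τ
  rw [key hX hY hd, key hY hX fun x hy hx => hd x hx hy, mul_comm]
  congr 1
  simp only [eq_iff_iff]
  exact forall_congr' fun x => ⟨fun h a b => h b a, fun h a b => h b a⟩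

/-! ### Finite range and commutator bounds -/

theorem ballNumber_lt_top (Γ : Set (Fin ν → ℤ)) (r : ℝ) : ballNumber Γ r < ⊤ := by
  have hfin : {z : Fin ν → ℤ | (dist1 0 z : ℝ) ≤ r}.Finite := by
    refine (Set.finite_Icc (fun _ => -⌈r⌉) (fun _ : Fin ν => ⌈r⌉)).subset fun z hz => ?_
    have hz' : (dist1 0 z : ℤ) ≤ ⌈r⌉ := by
      have : (dist1 0 z : ℝ) ≤ ⌈r⌉ := le_trans hz (Int.le_ceil r)
      exact_mod_cast this
    have hj : ∀ j, |z j| ≤ ⌈r⌉ := by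
      intro j
      have : (z j).natAbs ≤ dist1 0 z := by
        have := Finset.single_le_sum (f := fun j => ((0 : Fin ν → ℤ) j - z j).natAbs)
          (fun _ _ => Nat.zero_le _) (Finset.mem_univ j)
        simpa [dist1] using this
      calc |z j| = ((z j).natAbs : ℤ) := by simp
        _ ≤ dist1 0 z := by exact_mod_cast this
        _ ≤ _ := hz'
    exact ⟨fun j => (abs_le.1 (hj j)).1, fun j => (abs_le.1 (hj j)).2⟩
  refine lt_of_le_of_lt (iSup_le fun x => ?_) hfin.encard_lt_top
  refine Set.encard_le_encard_of_injOn (f := fun y : Γ => (y : Fin ν → ℤ) - (x : Fin ν → ℤ)) ?_ ?_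
  · intro y hy
    have : dist1 0 ((y : Fin ν → ℤ) - (x : Fin ν → ℤ)) = dist1 (x : Fin ν → ℤ) y := by
      simp [dist1]
    simpa [this] using hy
  · intro y _ z _ h
    exact Subtype.ext (sub_left_injective h)

theorem dist1_le_diam1 {X : Finset Γ} {x y : Γ} (hx : x ∈ X) (hy : y ∈ X) :
    dist1 (x : Fin ν → ℤ) y ≤ diam1 X :=
  (Finset.le_sup (f := fun y : Γ => dist1 (x : Fin ν → ℤ) y) hy).trans
    (Finset.le_sup (f := fun x : Γ => X.sup fun y => dist1 (x : Fin ν → ℤ) y) hx)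

namespace Interaction

variable {Φ : Interaction Γ d} {r : ℝ} {Λ : Finset Γ}

theorem HasRange.dist1_le (hrange : Φ.HasRange r) {Z : Finset Γ} (hZ : Φ.term Z ≠ 0) {x y : Γ}
    (hx : x ∈ Z) (hy : y ∈ Z) : (dist1 (x : Fin ν → ℤ) y : ℝ) ≤ r := by
  have h := not_lt.1 (mt (hrange Z) hZ)
  exact le_trans (by exact_mod_cast dist1_le_diam1 hx hy) h

theorem HasRange.card_le (hrange : Φ.HasRange r) {Z : Finset Γ} (hZ : Φ.term Z ≠ 0) {x : Γ}
    (hx : x ∈ Z) : Z.card ≤ (ballNumber Γ r).toNat := by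
  have h : (Z.card : ℕ∞) ≤ ballNumber Γ r := by
    rw [← Set.encard_coe_eq_coe_finsetCard]
    refine le_trans (Set.encard_le_encard ?_)
      (le_iSup (fun x : Γ => Set.encard {y : Γ | (dist1 (x : Fin ν → ℤ) y : ℝ) ≤ r}) x)
    intro y hy
    exact hrange.dist1_le hZ hx hy
  rw [← ENat.natCast_toNat (ballNumber_lt_top Γ r).ne] at h
  exact_mod_cast h

/-- In the strength of the interaction, any finite family of regions may replace the sum over all
regions. -/
theorem sum_norm_term_le (hbdd : Φ.strength < ⊤) (𝒵 : Finset (Finset Γ)) (x : Γ) :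
    ∑ Z ∈ 𝒵 with x ∈ Z, ‖Φ.term Z‖ ≤ Φ.strength.toReal := by
  rw [← ENNReal.ofReal_le_iff_le_toReal hbdd.ne, ENNReal.ofReal_sum_of_nonneg (by simp)]
  have h1 := ENNReal.sum_le_tsum (f := fun X : {X : Finset Γ // x ∈ X} =>
    ENNReal.ofReal ‖Φ.term X.1‖) (𝒵.subtype fun X => x ∈ X)
  rw [Finset.sum_subtype_eq_sum_filter (f := fun X => ENNReal.ofReal ‖Φ.term X‖)] at h1
  exact h1.trans (le_iSup (fun x : Γ => ∑' X : {X : Finset Γ // x ∈ X},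
    ENNReal.ofReal ‖Φ.term X.1‖) x)

theorem sum_norm_term_not_disjoint_le (hbdd : Φ.strength < ⊤) (𝒵 : Finset (Finset Γ))
    (S : Finset Γ) :
    ∑ Z ∈ 𝒵 with ¬ Disjoint Z S, ‖Φ.term Z‖ ≤ S.card * Φ.strength.toReal := by
  calc ∑ Z ∈ 𝒵 with ¬ Disjoint Z S, ‖Φ.term Z‖
      ≤ ∑ Z ∈ 𝒵, ∑ x ∈ S, if x ∈ Z then ‖Φ.term Z‖ else 0 := by
        rw [Finset.sum_filter]
        refine Finset.sum_le_sum fun Z _ => ?_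
        have h0 : ∀ x ∈ S, 0 ≤ if x ∈ Z then ‖Φ.term Z‖ else 0 := fun x _ => by positivity
        split_ifs with hZ
        · exact Finset.sum_nonneg h0
        · obtain ⟨x, hxZ, hxS⟩ := Finset.not_disjoint_iff.1 hZ
          calc ‖Φ.term Z‖ = if x ∈ Z then ‖Φ.term Z‖ else 0 := (if_pos hxZ).symm
            _ ≤ _ := Finset.single_le_sum h0 hxS
    _ = ∑ x ∈ S, ∑ Z ∈ 𝒵 with x ∈ Z, ‖Φ.term Z‖ := by
        rw [Finset.sum_comm]
        simp [Finset.sum_filter]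
    _ ≤ ∑ x ∈ S, Φ.strength.toReal := Finset.sum_le_sum fun x _ => sum_norm_term_le hbdd 𝒵 x
    _ = S.card * Φ.strength.toReal := by simp

theorem norm_termIn_le (Φ : Interaction Γ d) (Λ Z : Finset Γ) : ‖Φ.termIn Λ Z‖ ≤ ‖Φ.term Z‖ := by
  unfold termIn
  split_ifs with h
  · exact norm_embed_le h _
  · simp

theorem termIn_eq_zero {Z : Finset Γ} (hZ : Φ.term Z = 0) : Φ.termIn Λ Z = 0 :=
  norm_le_zero_iff.1 ((norm_termIn_le Φ Λ Z).trans (by simp [hZ]))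

theorem isHermitian_termIn (Φ : Interaction Γ d) (Λ Z : Finset Γ) :
    (Φ.termIn Λ Z).IsHermitian := by
  unfold termIn
  split_ifs with h
  · exact (embed_conjTranspose h _).symm.trans (congrArg (embed h) (Φ.isHermitian Z))
  · exact Matrix.isHermitian_zero

theorem commute_termIn (Φ : Interaction Γ d) (Λ : Finset Γ) {Y Z : Finset Γ} (h : Disjoint Y Z) :
    Commute (Φ.termIn Λ Y) (Φ.termIn Λ Z) := by
  unfold termIn
  split_ifs with hY hZ
  · exact embed_commute hY hZ h _ _
  all_goals simp

/-- `A` is localized in `S`, in the weak sense that it commutes with every interaction term of a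
region disjoint from `S`. Membership in `𝒜_S` implies this, and only this is needed to drop the
terms that do not touch `S` from a commutator. -/
def IsSupportedOn (Φ : Interaction Γ d) (S : Finset Γ) (A : Obs d Λ) : Prop :=
  ∀ W : Finset Γ, Disjoint W S → Commute (Φ.termIn Λ W) A

theorem isSupportedOn_hamBoundary (Φ : Interaction Γ d) (Λ B : Finset Γ) :
    Φ.IsSupportedOn B (Φ.hamBoundary Λ B) := fun _ hW =>
  Commute.sum_right _ _ _ fun _ hZ =>
    Φ.commute_termIn Λ (hW.mono_right (Finset.mem_powerset.1 hZ))

open scoped Classical in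
/-- A commutator with `Φ(Z)` enlarges the support at most by `Z`. -/
theorem IsSupportedOn.commutator_termIn {S : Finset Γ} {A : Obs d Λ} (hA : Φ.IsSupportedOn S A)
    (Z : Finset Γ) :
    Φ.IsSupportedOn (S ∪ Z) (Φ.termIn Λ Z * A - A * Φ.termIn Λ Z) := fun W hW => by
  rw [Finset.disjoint_union_right] at hW
  have h1 := hA W hW.1
  have h2 := Φ.commute_termIn Λ hW.2
  exact (h2.mul_right h1).sub_right (h1.mul_right h2)

/-- Each commutator costs a factor `2 𝔧_Φ |S|`, where `S` is the current support: `|S| 𝔧_Φ` bounds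
the total norm of the terms that touch `S`. It then enlarges the support by at most `N_Φ` sites. -/
theorem norm_iterate_commutator_le (hrange : Φ.HasRange r) (hbdd : Φ.strength < ⊤)
    (𝒵 : Finset (Finset Γ)) (n : ℕ) {S : Finset Γ} {A : Obs d Λ} (hA : Φ.IsSupportedOn S A) :
    ‖(fun X => (∑ Z ∈ 𝒵, Φ.termIn Λ Z) * X - X * ∑ Z ∈ 𝒵, Φ.termIn Λ Z)^[n] A‖ ≤
      ‖A‖ * ∏ i ∈ Finset.range n,
        (2 * Φ.strength.toReal * (S.card + i * (ballNumber Γ r).toNat)) := by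
  classical
  set f : Obs d Λ → Obs d Λ :=
    fun X => (∑ Z ∈ 𝒵, Φ.termIn Λ Z) * X - X * ∑ Z ∈ 𝒵, Φ.termIn Λ Z with hf
  set j := Φ.strength.toReal
  set N := (ballNumber Γ r).toNat
  have hj : 0 ≤ j := ENNReal.toReal_nonneg
  have hsum : ∀ (n : ℕ) (s : Finset (Finset Γ)) (g : Finset Γ → Obs d Λ),
      f^[n] (∑ Z ∈ s, g Z) = ∑ Z ∈ s, f^[n] (g Z) := by
    intro n s
    induction n with
    | zero => simp
    | succ n ih =>
      intro g
      simp only [Function.iterate_succ_apply]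
      rw [← ih]
      simp only [hf, Finset.mul_sum s, Finset.sum_mul s, Finset.sum_sub_distrib]
  have hzero : ∀ n : ℕ, f^[n] 0 = 0 := fun n => by simpa using hsum n ∅ 0
  induction n generalizing S A with
  | zero => simp
  | succ n ih =>
    set c : Finset Γ → Obs d Λ := fun Z => Φ.termIn Λ Z * A - A * Φ.termIn Λ Z with hc
    have hfA : f A = ∑ Z ∈ 𝒵 with ¬ Disjoint Z S, c Z := by
      rw [Finset.sum_filter_of_ne]
      · simp only [hf, hc, Finset.sum_mul, Finset.mul_sum, Finset.sum_sub_distrib]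
      · intro Z _ hne hdis
        exact hne (sub_eq_zero.2 (hA Z hdis).eq)
    set p : ℝ := ∏ i ∈ Finset.range n, (2 * j * (S.card + (i + 1 : ℕ) * N)) with hp
    have hp0 : 0 ≤ p := Finset.prod_nonneg fun i _ => by positivity
    have hterm : ∀ Z ∈ 𝒵.filter fun Z => ¬ Disjoint Z S,
        ‖f^[n] (c Z)‖ ≤ ‖Φ.term Z‖ * (2 * ‖A‖ * p) := by
      intro Z hZ
      by_cases h0 : Φ.term Z = 0
      · simp [hc, termIn_eq_zero h0, hzero, h0]
      obtain ⟨x, hxZ, -⟩ := Finset.not_disjoint_iff.1 (Finset.mem_filter.1 hZ).2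
      have hcard : ((S ∪ Z).card : ℝ) ≤ S.card + N := by
        exact_mod_cast (Finset.card_union_le S Z).trans
          (Nat.add_le_add_left (hrange.card_le h0 hxZ) _)
      have hcZ : ‖c Z‖ ≤ 2 * ‖Φ.term Z‖ * ‖A‖ := by
        have hZn := norm_termIn_le Φ Λ Z
        calc ‖c Z‖ ≤ ‖Φ.termIn Λ Z‖ * ‖A‖ + ‖A‖ * ‖Φ.termIn Λ Z‖ :=
              (norm_sub_le _ _).trans (add_le_add (norm_mul_le _ _) (norm_mul_le _ _))
          _ = 2 * ‖Φ.termIn Λ Z‖ * ‖A‖ := by ring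
          _ ≤ _ := by gcongr
      calc ‖f^[n] (c Z)‖
          ≤ ‖c Z‖ * ∏ i ∈ Finset.range n, (2 * j * ((S ∪ Z).card + i * N)) :=
            ih (hA.commutator_termIn Z)
        _ ≤ (2 * ‖Φ.term Z‖ * ‖A‖) * p := by
            refine mul_le_mul hcZ ?_ (Finset.prod_nonneg fun i _ => by positivity)
              (by positivity)
            refine Finset.prod_le_prod (fun i _ => by positivity) fun i _ => ?_
            gcongr 2 * j * ?_
            push_cast
            linarith
        _ = _ := by ring
    calc ‖f^[n + 1] A‖ = ‖∑ Z ∈ 𝒵 with ¬ Disjoint Z S, f^[n] (c Z)‖ := by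
          rw [Function.iterate_succ_apply, hfA, hsum]
      _ ≤ ∑ Z ∈ 𝒵 with ¬ Disjoint Z S, ‖Φ.term Z‖ * (2 * ‖A‖ * p) := norm_sum_le_of_le _ hterm
      _ = (∑ Z ∈ 𝒵 with ¬ Disjoint Z S, ‖Φ.term Z‖) * (2 * ‖A‖ * p) := by rw [Finset.sum_mul]
      _ ≤ (S.card * j) * (2 * ‖A‖ * p) := by
          gcongr
          exact sum_norm_term_not_disjoint_le hbdd 𝒵 S
      _ = _ := by
          rw [Finset.prod_range_succ', hp]
          push_cast
          ring

theorem norm_iterate_commutator_le_factorial (hrange : Φ.HasRange r) (hbdd : Φ.strength < ⊤)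
    (𝒵 : Finset (Finset Γ)) (n : ℕ) {S : Finset Γ} {A : Obs d Λ} (hA : Φ.IsSupportedOn S A) :
    ‖(fun X => (∑ Z ∈ 𝒵, Φ.termIn Λ Z) * X - X * ∑ Z ∈ 𝒵, Φ.termIn Λ Z)^[n] A‖ ≤
      ‖A‖ * (n.factorial *
        (2 * Φ.strength.toReal * ((ballNumber Γ r).toNat + S.card)) ^ n) := by
  refine (norm_iterate_commutator_le hrange hbdd 𝒵 n hA).trans ?_
  have hj : 0 ≤ Φ.strength.toReal := ENNReal.toReal_nonneg
  refine mul_le_mul_of_nonneg_left ?_ (norm_nonneg _)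
  rw [← Finset.prod_range_add_one_eq_factorial, Nat.cast_prod, ← Finset.card_range n,
    ← Finset.prod_const, Finset.card_range, ← Finset.prod_mul_distrib]
  refine Finset.prod_le_prod (fun i _ => by positivity) fun i _ => ?_
  have h1 : (0 : ℝ) ≤ i * S.card + (ballNumber Γ r).toNat := by positivity
  push_cast
  nlinarith [mul_nonneg hj h1]

theorem hamDecoupled_eq_sum {L B : Finset Γ} :
    Φ.hamDecoupled Λ L B =
      ∑ Z ∈ (L.powerset.filter fun Z => (Z \ B).Nonempty) ∪
        ((Λ \ L).powerset.filter fun Z => (Z \ B).Nonempty), Φ.termIn Λ Z := by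
  rw [Finset.sum_union]
  · rfl
  · refine Finset.disjoint_left.2 fun Z h1 h2 => ?_
    simp only [Finset.mem_filter, Finset.mem_powerset] at h1 h2
    obtain ⟨x, hx⟩ := h1.2
    have hxZ := (Finset.mem_sdiff.1 hx).1
    exact (Finset.mem_sdiff.1 (h2.1 hxZ)).2 (h1.1 hxZ)

/-- A region that meets both `L` and `L^c` and carries a nonzero term has diameter at most `r`, so
all its sites are close to the other side and it lies in `∂L`. -/
theorem ham_eq_hamBoundary_add_hamDecoupled (hrange : Φ.HasRange r) {L B : Finset Γ}
    (hL : L ⊆ Λ) (hB : IsBoundaryRegion r Λ L B) :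
    Φ.ham Λ = Φ.hamBoundary Λ B + Φ.hamDecoupled Λ L B := by
  rw [hamDecoupled_eq_sum, hamBoundary, ← Finset.sum_union]
  · symm
    refine Finset.sum_subset ?_ fun Z hZ hZ' => termIn_eq_zero ?_
    · intro Z
      simp only [Finset.mem_union, Finset.mem_filter, Finset.mem_powerset]
      rintro (h | h | h)
      · exact h.trans hB.1
      · exact h.1.trans hL
      · exact h.1.trans Finset.sdiff_subset
    · by_contra h0
      simp only [Finset.mem_union, Finset.mem_filter, Finset.mem_powerset, not_or, not_and,
        Finset.sdiff_nonempty] at hZ hZ'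
      obtain ⟨hZB, hZL, hZLc⟩ := hZ'
      have h1 : ¬ Z ⊆ L := fun h => hZL h hZB
      have h2 : ¬ Z ⊆ Λ \ L := fun h => hZLc h hZB
      obtain ⟨y, hyZ, hyL⟩ := Finset.not_subset.1 h1
      obtain ⟨x, hxZ, hx⟩ := Finset.not_subset.1 h2
      have hxL : x ∈ L := by
        by_contra hxL
        exact hx (Finset.mem_sdiff.2 ⟨hZ hxZ, hxL⟩)
      refine hZB fun z hz => ?_
      by_cases hzL : z ∈ L
      · exact hB.2.1 z hzL ⟨y, Finset.mem_sdiff.2 ⟨hZ hyZ, hyL⟩, hrange.dist1_le h0 hz hyZ⟩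
      · exact hB.2.2 z (Finset.mem_sdiff.2 ⟨hZ hz, hzL⟩) ⟨x, hxL, hrange.dist1_le h0 hz hxZ⟩
  · refine Finset.disjoint_left.2 fun Z h1 h2 => ?_
    simp only [Finset.mem_union, Finset.mem_filter, Finset.mem_powerset,
      Finset.sdiff_nonempty] at h1 h2
    tauto

theorem isHermitian_hamBoundary (Φ : Interaction Γ d) (Λ B : Finset Γ) :
    (Φ.hamBoundary Λ B).IsHermitian :=
  isSelfAdjoint_sum _ fun Z _ => isHermitian_termIn Φ Λ Z

theorem isHermitian_hamDecoupled (Φ : Interaction Γ d) (Λ L B : Finset Γ) :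
    (Φ.hamDecoupled Λ L B).IsHermitian := by
  rw [hamDecoupled_eq_sum]
  exact isSelfAdjoint_sum _ fun Z _ => isHermitian_termIn Φ Λ Z

/-- Also true if the decay rate is a division by zero: then it equals `0` and only `s = 0` is
allowed. -/
theorem norm_exp_conj_hamBoundary_le (hrange : Φ.HasRange r) (hbdd : Φ.strength < ⊤)
    (L B : Finset Γ) {s : ℝ} (hs : 0 ≤ s) (hs' : s ≤ decayRate Φ r B) :
    ‖NormedSpace.exp (s • Φ.hamDecoupled Λ L B) * Φ.hamBoundary Λ B *
      NormedSpace.exp (-(s • Φ.hamDecoupled Λ L B))‖ ≤ 2 * ‖Φ.hamBoundary Λ B‖ := by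
  rw [hamDecoupled_eq_sum]
  have hj : 0 ≤ Φ.strength.toReal := ENNReal.toReal_nonneg
  set c : ℝ := 2 * Φ.strength.toReal * ((ballNumber Γ r).toNat + B.card) with hc
  have hc0 : 0 ≤ c := by positivity
  refine norm_exp_smul_mul_mul_exp_neg_le hc0 hs ?_ fun n =>
    norm_iterate_commutator_le_factorial hrange hbdd _ n (isSupportedOn_hamBoundary Φ Λ B)
  have hlam : decayRate Φ r B = 1 / (2 * c) := by rw [decayRate, hc]; ring_nf
  rw [hlam] at hs'
  rcases hc0.eq_or_lt with h0 | h0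
  · simp [← h0]
  · calc s * c ≤ 1 / (2 * c) * c := by gcongr
      _ = 1 / 2 := by field_simp

end Interaction

end Lattice

/-! ### Spectral projections and the energy truncation -/

section Spectral

open NormedSpace Set
open scoped MatrixOrder

variable {n : Type*} [Fintype n] [DecidableEq n] {A K V : Matrix n n ℂ}

/-- The spectrum is finite, so the functional calculus applies to every function. -/
theorem continuousOn_spectrum (f : ℝ → ℝ) (A : Matrix n n ℂ) : ContinuousOn f (spectrum ℝ A) :=
  (Matrix.finite_real_spectrum (A := A)).continuousOn f

theorem cfc_mul_cfc (f g : ℝ → ℝ) (A : Matrix n n ℂ) :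
    cfc f A * cfc g A = cfc (fun x => f x * g x) A :=
  (cfc_mul f g A (continuousOn_spectrum f A) (continuousOn_spectrum g A)).symm

theorem exp_smul_cfc (hA : IsSelfAdjoint A) (s : ℝ) (f : ℝ → ℝ) :
    exp (s • cfc f A) = cfc (fun x => Real.exp (s * f x)) A := by
  rw [← CFC.real_exp_eq_normedSpace_exp (IsSelfAdjoint.smul (.all s) (cfc_predicate f A)),
    ← cfc_const_mul s f A (continuousOn_spectrum _ _),
    ← cfc_comp' Real.exp (fun x => s * f x) A (by fun_prop) (continuousOn_spectrum _ _)]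

theorem exp_smul_eq_cfc (hA : IsSelfAdjoint A) (s : ℝ) :
    exp (s • A) = cfc (fun x => Real.exp (s * x)) A := by
  have := exp_smul_cfc hA s id
  rwa [cfc_id ℝ A hA] at this

theorem norm_specProj_le_one (A : Matrix n n ℂ) (I : Set ℝ) : ‖specProj A I‖ ≤ 1 := by
  refine norm_cfc_le zero_le_one fun x _ => ?_
  by_cases hx : x ∈ I <;> simp [hx]

theorem one_sub_specProj (hA : IsSelfAdjoint A) (I : Set ℝ) :
    1 - specProj A I = specProj A Iᶜ := by
  rw [specProj, specProj, ← cfc_one ℝ A hA, ← cfc_sub _ _ _ (continuousOn_spectrum _ _)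
    (continuousOn_spectrum _ _)]
  refine congrArg (cfc · A) ?_
  funext x
  by_cases hx : x ∈ I <;> simp [hx]

theorem mul_specProj (hA : IsSelfAdjoint A) (I : Set ℝ) :
    A * specProj A I = cfc (fun x => x * I.indicator 1 x) A := by
  have := cfc_mul_cfc id (I.indicator 1) A
  rwa [cfc_id ℝ A hA] at this

/-- The truncation sends the spectrum in `(-∞, -M]` to `0`; if there is none, it is the minimum with
`M`. -/
theorem truncate_eq_cfc (hK : IsSelfAdjoint K) {M : ℝ} (hKM : ∀ x ∈ spectrum ℝ K, -M < x) :
    truncate K M = cfc (fun x => min x M) K := by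
  rw [truncate, mul_specProj hK, specProj, ← cfc_smul M _ K (continuousOn_spectrum _ _),
    ← cfc_add _ _ _ (continuousOn_spectrum _ _) (continuousOn_spectrum _ _)]
  refine cfc_congr fun x hx => ?_
  rcases lt_or_ge x M with h | h
  · have h1 : x ∈ Ioo (-M) M := ⟨hKM x hx, h⟩
    simp [h1, h.le, h]
  · have h1 : x ∉ Ioo (-M) M := fun h' => h'.2.not_ge h
    simp [h1, h]

/-- The truncated evolution is controlled by the untruncated one: to the right of `E^K(-∞, M)` it is
the untruncated one times the contraction `e^{s(T - K)}`, and to the right of `E^K[M, ∞)` it is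
`e^{s(T - M)} V`, with `e^{s(T - M)}` a contraction. -/
theorem norm_exp_conj_truncate_le (hK : IsSelfAdjoint K) {M : ℝ}
    (hKM : ∀ x ∈ spectrum ℝ K, -M < x) {s : ℝ} (hs : 0 ≤ s)
    (hconj : ‖exp (s • K) * V * exp (-(s • K))‖ ≤ 2 * ‖V‖) :
    ‖exp (s • truncate K M) * V * exp (-(s • truncate K M))‖ ≤ 3 * ‖V‖ := by
  have hneg : ∀ X : Matrix n n ℂ, -(s • X) = (-s) • X := fun X => (neg_smul s X).symm
  rw [truncate_eq_cfc hK hKM, hneg, exp_smul_cfc hK, exp_smul_cfc hK]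
  rw [hneg, exp_smul_eq_cfc hK, exp_smul_eq_cfc hK] at hconj
  set E := cfc (fun x => Real.exp (s * min x M)) K
  set E' := cfc (fun x => Real.exp (-s * min x M)) K
  set F := cfc (fun x => Real.exp (s * x)) K
  set F' := cfc (fun x => Real.exp (-s * x)) K
  have hR : specProj K (Iio M) + specProj K (Ici M) = 1 := by
    have := one_sub_specProj hK (Iio M)
    rw [compl_Iio] at this
    rw [← this]; abel
  -- Below the cutoff, the truncated flow is a contraction times the untruncated one.
  have hlow : E * V * E' * specProj K (Iio M) =
      cfc (fun x => Real.exp (s * (min x M - x))) K * (F * V * F') * specProj K (Iio M) := by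
    have h1 : E = cfc (fun x => Real.exp (s * (min x M - x))) K * F := by
      rw [cfc_mul_cfc]
      refine congrArg (cfc · K) (funext fun x => ?_)
      rw [← Real.exp_add]; ring_nf
    have h2 : E' * specProj K (Iio M) = F' * specProj K (Iio M) := by
      simp only [E', F', specProj, cfc_mul_cfc]
      refine congrArg (cfc · K) (funext fun x => ?_)
      by_cases hx : x < M
      · simp [hx, hx.le]
      · simp [hx]
    rw [mul_assoc _ E', h2, h1]
    simp only [mul_assoc]
  -- Above the cutoff, `T = M`, so the scalar `e^{-sM}` can be moved to the left factor.
  have hhigh : E * V * E' * specProj K (Ici M) =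
      cfc (fun x => Real.exp (s * (min x M - M))) K * V * specProj K (Ici M) := by
    have h1 : cfc (fun x => Real.exp (s * (min x M - M))) K = Real.exp (-s * M) • E := by
      rw [← cfc_smul _ _ K (continuousOn_spectrum _ _)]
      refine congrArg (cfc · K) (funext fun x => ?_)
      rw [smul_eq_mul, ← Real.exp_add]; ring_nf
    have h2 : E' * specProj K (Ici M) = Real.exp (-s * M) • specProj K (Ici M) := by
      simp only [E', specProj, cfc_mul_cfc]
      rw [← cfc_smul _ _ K (continuousOn_spectrum _ _)]
      refine congrArg (cfc · K) (funext fun x => ?_)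
      by_cases hx : M ≤ x
      · simp [hx]
      · simp [hx]
    rw [mul_assoc _ E', h2, h1]
    simp only [mul_smul_comm, smul_mul_assoc]
  have hc : ∀ g : ℝ → ℝ, (∀ x, g x ≤ 0) → ‖cfc (fun x => Real.exp (s * g x)) K‖ ≤ 1 := by
    intro g hg
    refine norm_cfc_le zero_le_one fun x _ => ?_
    rw [Real.norm_of_nonneg (Real.exp_nonneg _), Real.exp_le_one_iff]
    exact mul_nonpos_of_nonneg_of_nonpos hs (hg x)
  have hc1 := hc (fun x => min x M - x) fun x => by simp
  have hc2 := hc (fun x => min x M - M) fun x => by simp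
  calc ‖E * V * E'‖
      = ‖E * V * E' * specProj K (Iio M) + E * V * E' * specProj K (Ici M)‖ := by
        rw [← mul_add, hR, mul_one]
    _ ≤ ‖cfc (fun x => Real.exp (s * (min x M - x))) K‖ * ‖F * V * F'‖ * ‖specProj K (Iio M)‖ +
        ‖cfc (fun x => Real.exp (s * (min x M - M))) K‖ * ‖V‖ * ‖specProj K (Ici M)‖ := by
        rw [hlow, hhigh]
        exact (norm_add_le _ _).trans (add_le_add (norm_mul₃_le) (norm_mul₃_le))
    _ ≤ 1 * (2 * ‖V‖) * 1 + 1 * ‖V‖ * 1 := by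
        gcongr
        exacts [norm_specProj_le_one _ _, norm_specProj_le_one _ _]
    _ = 3 * ‖V‖ := by ring

/-- States of truncated energy at most `p` hardly reach the energies of `K` above the cutoff:
`E^K[M, ∞) = e^{-λM} E^K[M, ∞) e^{λT}`, and `e^{-λ(V + T)}` costs a factor `e^{λp}` on these
states. -/
theorem norm_specProj_Ici_mul_specProj_Iic_le (hK : IsSelfAdjoint K) (hV : IsSelfAdjoint V)
    {M : ℝ} (hKM : ∀ x ∈ spectrum ℝ K, -M < x) {lam : ℝ} (hlam : 0 ≤ lam)
    (hconj : ∀ s, 0 ≤ s → s ≤ lam → ‖exp (s • K) * V * exp (-(s • K))‖ ≤ 2 * ‖V‖) (p : ℝ) :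
    ‖specProj K (Ici M) * specProj (V + truncate K M) (Iic p)‖ ≤
      Real.exp (-lam * (M - p - 3 * ‖V‖)) := by
  rcases isEmpty_or_nonempty n with hn | hn
  · rw [Subsingleton.elim (specProj K (Ici M) * _) 0, norm_zero]
    positivity
  have hT : IsSelfAdjoint (truncate K M) := by
    rw [truncate_eq_cfc hK hKM]
    exact cfc_predicate _ _
  have hG : IsSelfAdjoint (V + truncate K M) := hV.add hT
  have hdyson := norm_exp_mul_exp_neg_le hlam fun s h0 h1 =>
    norm_exp_conj_truncate_le hK hKM h0 (hconj s h0 h1)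
  have h1 : specProj K (Ici M) =
      Real.exp (-lam * M) • (specProj K (Ici M) * exp (lam • truncate K M)) := by
    rw [truncate_eq_cfc hK hKM, exp_smul_cfc hK, specProj, cfc_mul_cfc,
      ← cfc_smul _ _ K (continuousOn_spectrum _ _)]
    refine congrArg (cfc · K) (funext fun x => ?_)
    by_cases hx : M ≤ x
    · simp [hx, ← Real.exp_add]
    · simp [hx]
  set G := V + truncate K M with hGdef
  have h2 : specProj G (Iic p) =
      exp (-(lam • G)) * cfc (fun x => Real.exp (lam * x) * (Iic p).indicator 1 x) G := by
    rw [← neg_smul, exp_smul_eq_cfc hG, cfc_mul_cfc, specProj]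
    refine congrArg (cfc · G) (funext fun x => ?_)
    rw [← mul_assoc, ← Real.exp_add]
    simp
  have h3 : ‖cfc (fun x => Real.exp (lam * x) * (Iic p).indicator 1 x) G‖ ≤
      Real.exp (lam * p) := by
    refine norm_cfc_le (Real.exp_nonneg _) fun x _ => ?_
    by_cases hx : x ≤ p
    · simp [hx]
      gcongr
    · simp [hx, Real.exp_nonneg]
  calc ‖specProj K (Ici M) * specProj G (Iic p)‖
      = Real.exp (-lam * M) *
          ‖specProj K (Ici M) * (exp (lam • truncate K M) * exp (-(lam • G))) *
            cfc (fun x => Real.exp (lam * x) * (Iic p).indicator 1 x) G‖ := by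
        rw [h2]
        conv_lhs => rw [h1]
        rw [smul_mul_assoc, norm_smul, Real.norm_of_nonneg (Real.exp_nonneg _)]
        simp only [mul_assoc]
    _ ≤ Real.exp (-lam * M) * (1 * Real.exp (3 * ‖V‖ * lam) * Real.exp (lam * p)) := by
        gcongr
        refine norm_mul₃_le.trans ?_
        gcongr
        exact norm_specProj_le_one _ _
    _ = Real.exp (-lam * (M - p - 3 * ‖V‖)) := by
        rw [one_mul, ← Real.exp_add, ← Real.exp_add]
        ring_nf

/-- A Markov inequality for `V + K + a` on states from a spectral subspace of the truncated
operator. The bound only involves the norm of the truncated operator, because `V + K` is applied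
below the cutoff only, where it agrees with the truncated operator; the rest of the state has norm
at most `κ`. -/
theorem norm_specProj_compl_mul_le (hH : IsSelfAdjoint (V + K)) (hK : IsSelfAdjoint K)
    {M : ℝ} (hKM : ∀ x ∈ spectrum ℝ K, -M < x) {I J : Set ℝ} {a m b κ : ℝ} (hm : 0 < m)
    (hI : ∀ x ∈ spectrum ℝ (V + K), x ∉ I → m ≤ |x + a|)
    (hJ : ‖(V + truncate K M + algebraMap ℝ _ a) * specProj (V + truncate K M) J‖ ≤ b)
    (hκ : ‖specProj K (Ici M) * specProj (V + truncate K M) J‖ ≤ κ) :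
    ‖(1 - specProj (V + K) I) * specProj (V + truncate K M) J‖ ≤
      (b + (‖V + truncate K M + algebraMap ℝ _ a‖ + m) * κ) / m := by
  set G := V + truncate K M with hG
  set P := specProj G J
  set R := specProj K (Iio M)
  set R' := specProj K (Ici M)
  have hR : R = 1 - R' := by
    have := one_sub_specProj hK (Ici M)
    rw [compl_Ici] at this
    exact this.symm
  rw [one_sub_specProj hH]
  set Q := specProj (V + K) Iᶜ
  have hcut : (V + K + algebraMap ℝ _ a) * R = (G + algebraMap ℝ _ a) * R := by
    have : truncate K M * R = K * R := by
      rw [mul_specProj hK, truncate_eq_cfc hK hKM]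
      simp only [R, specProj, cfc_mul_cfc]
      refine congrArg (cfc · K) (funext fun x => ?_)
      by_cases hx : x < M
      · simp [hx, hx.le]
      · simp [hx]
    rw [hG]
    simp only [add_mul, this]
  obtain ⟨Y, hY, hQ⟩ : ∃ Y : Matrix n n ℂ, ‖Y‖ ≤ 1 / m ∧ Q = Y * (V + K + algebraMap ℝ _ a) := by
    refine ⟨cfc (fun x => Iᶜ.indicator 1 x * (x + a)⁻¹) (V + K), ?_, ?_⟩
    · refine norm_cfc_le (by positivity) fun x hx => ?_
      by_cases hxI : x ∈ I
      · simp [hxI, hm.le]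
      · have := hI x hx hxI
        simp [hxI]
        exact inv_anti₀ hm this
    · have h1 : V + K + algebraMap ℝ _ a = cfc (fun x => x + a) (V + K) := by
        rw [cfc_add_const a (fun x => x) _ (continuousOn_spectrum _ _) hH, cfc_id' ℝ _ hH]
      conv_rhs => rw [h1]
      rw [cfc_mul_cfc]
      refine cfc_congr fun x hx => ?_
      by_cases hxI : x ∈ I
      · simp [hxI]
      · have h0 : x + a ≠ 0 := abs_pos.1 (hm.trans_le (hI x hx hxI))
        simp [hxI, h0]
  have hdecomp : Q * P = Y * ((G + algebraMap ℝ _ a) * P - (G + algebraMap ℝ _ a) * (R' * P)) +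
      Q * (R' * P) := by
    have h1 : P = R * P + R' * P := by rw [hR]; noncomm_ring
    have h2 : Q * (R * P) =
        Y * ((G + algebraMap ℝ _ a) * P - (G + algebraMap ℝ _ a) * (R' * P)) := by
      rw [hQ, mul_assoc, ← mul_assoc _ R, hcut, hR]
      noncomm_ring
    conv_lhs => rw [h1, mul_add, h2]
  rw [hdecomp]
  have hκ0 : 0 ≤ κ := (norm_nonneg _).trans hκ
  have hb0 : 0 ≤ b := (norm_nonneg _).trans hJ
  calc _ ≤ ‖Y‖ * (‖(G + algebraMap ℝ _ a) * P‖ + ‖G + algebraMap ℝ _ a‖ * ‖R' * P‖) +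
        ‖Q‖ * ‖R' * P‖ := by
        refine (norm_add_le _ _).trans (add_le_add ?_ (norm_mul_le _ _))
        refine (norm_mul_le _ _).trans ?_
        gcongr
        refine (norm_sub_le _ _).trans ?_
        gcongr
        exact norm_mul_le _ _
    _ ≤ 1 / m * (b + ‖G + algebraMap ℝ _ a‖ * κ) + 1 * κ := by
        gcongr
        exact norm_specProj_le_one _ _
    _ = _ := by field_simp; ring

theorem neg_norm_le_of_mem_spectrum_of_add_nonneg (hV : IsSelfAdjoint V) (hK : IsSelfAdjoint K)
    (hpos : 0 ≤ V + K) {x : ℝ} (hx : x ∈ spectrum ℝ K) : -‖V‖ ≤ x := by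
  refine (algebraMap_le_iff_le_spectrum hK).1 ?_ x hx
  have h1 : V ≤ algebraMap ℝ _ ‖V‖ := hV.le_algebraMap_norm_self
  rw [map_neg]
  calc -(algebraMap ℝ _ ‖V‖) ≤ -V := neg_le_neg h1
    _ ≤ K := neg_le_iff_add_nonneg'.2 hpos

theorem specProj_mul_of_subset (A : Matrix n n ℂ) {I J : Set ℝ} (h : J ⊆ I) :
    specProj A I * specProj A J = specProj A J := by
  simp only [specProj, cfc_mul_cfc]
  refine congrArg (cfc · A) (funext fun x => ?_)
  by_cases hx : x ∈ J
  · simp [hx, h hx]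
  · simp [hx]

theorem norm_add_algebraMap_mul_specProj_le (hA : IsSelfAdjoint A) {J : Set ℝ} {a b : ℝ}
    (hb : 0 ≤ b) (h : ∀ x ∈ spectrum ℝ A, x ∈ J → |x + a| ≤ b) :
    ‖(A + algebraMap ℝ _ a) * specProj A J‖ ≤ b := by
  have h1 : A + algebraMap ℝ _ a = cfc (fun x => x + a) A := by
    rw [cfc_add_const a (fun x => x) _ (continuousOn_spectrum _ _) hA, cfc_id' ℝ _ hA]
  rw [h1, specProj, cfc_mul_cfc]
  refine norm_cfc_le hb fun x hx => ?_
  by_cases hxJ : x ∈ J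
  · simpa [hxJ] using h x hx hxJ
  · simpa [hxJ] using hb

theorem norm_add_truncate_add_algebraMap_le (V : Matrix n n ℂ) (hK : IsSelfAdjoint K) {M a : ℝ}
    (hKM : ∀ x ∈ spectrum ℝ K, -M < x) (hM : 0 ≤ M) (ha : 0 ≤ a) :
    ‖V + truncate K M + algebraMap ℝ _ a‖ ≤ ‖V‖ + M + a := by
  rw [truncate_eq_cfc hK hKM, add_assoc,
    ← cfc_add_const a _ _ (continuousOn_spectrum _ _) hK, add_assoc]
  refine (norm_add_le _ _).trans (add_le_add le_rfl (norm_cfc_le (by positivity) fun x hx => ?_))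
  have h1 := hKM x hx
  have h2 : -M ≤ min x M := le_min h1.le (by linarith)
  rw [Real.norm_eq_abs, abs_le]
  exact ⟨by linarith, by linarith [min_le_right x M]⟩

theorem neg_two_mul_norm_le_of_mem_spectrum_truncate (hV : IsSelfAdjoint V)
    (hK : IsSelfAdjoint K) {M : ℝ} (hM : ‖V‖ < M) (hKV : ∀ x ∈ spectrum ℝ K, -‖V‖ ≤ x) {x : ℝ}
    (hx : x ∈ spectrum ℝ (V + truncate K M)) : -2 * ‖V‖ ≤ x := by
  have h0 := norm_nonneg V
  have hKM : ∀ x ∈ spectrum ℝ K, -M < x := fun x hx => by linarith [hKV x hx]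
  have hT : IsSelfAdjoint (truncate K M) := by
    rw [truncate_eq_cfc hK hKM]
    exact cfc_predicate _ _
  refine (algebraMap_le_iff_le_spectrum (hV.add hT)).1 ?_ x hx
  have h1 : -(algebraMap ℝ _ ‖V‖) ≤ V := hV.neg_algebraMap_norm_le_self
  have h2 : algebraMap ℝ _ (-‖V‖) ≤ truncate K M := by
    rw [truncate_eq_cfc hK hKM]
    exact algebraMap_le_cfc _ _ _ (fun x hx => le_min (hKV x hx) (by linarith))
      (continuousOn_spectrum _ _) hK
  calc algebraMap ℝ (Matrix n n ℂ) (-2 * ‖V‖)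
      = -(algebraMap ℝ _ ‖V‖) + algebraMap ℝ _ (-‖V‖) := by
        rw [← map_neg, ← map_add]; ring_nf
    _ ≤ V + truncate K M := add_le_add h1 h2

end Spectral

theorem exp_neg_mul_le_two_mul_sqrt_two_mul_exp {lam x y : ℝ} (hlam : 0 ≤ lam) (h : y ≤ x) :
    Real.exp (-lam * x) ≤ 2 * √2 * Real.exp (-lam * y) := by
  have h1 : 1 ≤ 2 * √2 := by
    have : 1 ≤ √2 := Real.one_le_sqrt.2 one_le_two
    linarith
  calc Real.exp (-lam * x) ≤ Real.exp (-lam * y) := by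
        gcongr Real.exp ?_
        exact mul_le_mul_of_nonpos_left h (by linarith)
    _ ≤ 2 * √2 * Real.exp (-lam * y) := le_mul_of_one_le_left (Real.exp_nonneg _) h1

end SpinSystem

open SpinSystem in
theorem theorem3p1 {ν d : ℕ} (Γ : Set (Fin ν → ℤ)) (Φ : Interaction Γ d) (r : ℝ)
    (hrange : Φ.HasRange r) (hbdd : Φ.strength < ⊤)
    (Λ L B : Finset Γ) (hL : L ⊆ Λ) (hB : IsBoundaryRegion r Λ L B)
    (hpos : (Φ.ham Λ).PosSemidef)
    (M : ℝ) (hM : ‖Φ.hamBoundary Λ B‖ < M) :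
    ballNumber Γ r < ⊤ ∧
    (∀ p q : ℝ, -2 * ‖Φ.hamBoundary Λ B‖ ≤ p → p < q →
      ‖(1 - specProj (Φ.ham Λ) (Set.Iio q)) * specProj (Φ.hamTrunc Λ L B M) (Set.Iic p)‖ ≤
        (p + 2 * ‖Φ.hamBoundary Λ B‖
            + deltaErr (decayRate Φ r B) M ‖Φ.hamBoundary Λ B‖ p q)
          / (q + 2 * ‖Φ.hamBoundary Λ B‖)) ∧
    (∀ ε δ : ℝ, 0 ≤ ε → ε < δ →
      ‖(1 - specProj (Φ.ham Λ) (Set.Ioo (-δ) δ)) *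
          specProj (Φ.hamTrunc Λ L B M) (Set.Icc (-ε) ε)‖ ≤
        (ε + etaErr (decayRate Φ r B) M ‖Φ.hamBoundary Λ B‖ ε δ) / δ) := by
  refine ⟨ballNumber_lt_top Γ r, ?_⟩
  have hlam : 0 ≤ decayRate Φ r B := by
    rw [decayRate]
    have : 0 ≤ Φ.strength.toReal := ENNReal.toReal_nonneg
    positivity
  have hconj : ∀ s, 0 ≤ s → s ≤ decayRate Φ r B → _ := fun s hs hs' =>
    Interaction.norm_exp_conj_hamBoundary_le (Λ := Λ) hrange hbdd L B hs hs'
  rw [Interaction.ham_eq_hamBoundary_add_hamDecoupled hrange hL hB] at hpos ⊢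
  rw [Interaction.hamTrunc]
  have hV : IsSelfAdjoint (Φ.hamBoundary Λ B) := Φ.isHermitian_hamBoundary Λ B
  have hK : IsSelfAdjoint (Φ.hamDecoupled Λ L B) := Φ.isHermitian_hamDecoupled Λ L B
  set V := Φ.hamBoundary Λ B
  set K := Φ.hamDecoupled Λ L B
  set lam := decayRate Φ r B
  have h0 : 0 ≤ ‖V‖ := norm_nonneg V
  have hKV : ∀ x ∈ spectrum ℝ K, -‖V‖ ≤ x := fun x hx =>
    neg_norm_le_of_mem_spectrum_of_add_nonneg hV hK (Matrix.nonneg_iff_posSemidef.2 hpos) hx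
  have hKM : ∀ x ∈ spectrum ℝ K, -M < x := fun x hx => by linarith [hKV x hx]
  have hT : IsSelfAdjoint (truncate K M) := by
    rw [truncate_eq_cfc hK hKM]
    exact cfc_predicate _ _
  have htail := norm_specProj_Ici_mul_specProj_Iic_le hK hV hKM hlam hconj
  constructor
  · intro p q hp hpq
    have hκ := (htail p).trans (exp_neg_mul_le_two_mul_sqrt_two_mul_exp hlam
      (show M - 2 * p - 18 * ‖V‖ ≤ M - p - 3 * ‖V‖ by linarith))
    refine (norm_specProj_compl_mul_le (a := 2 * ‖V‖) (m := q + 2 * ‖V‖) (hV.add hK) hK hKM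
      (by linarith) (fun x _ hx => ?_)
      (norm_add_algebraMap_mul_specProj_le (b := p + 2 * ‖V‖) (hV.add hT) (by linarith)
        fun x hx hxp => ?_) hκ).trans ?_
    · exact (add_le_add (not_lt.1 hx) le_rfl).trans (le_abs_self _)
    · have := neg_two_mul_norm_le_of_mem_spectrum_truncate hV hK hM hKV hx
      rw [abs_of_nonneg (by linarith)]
      exact add_le_add hxp le_rfl
    · have hG := norm_add_truncate_add_algebraMap_le V hK hKM (h0.trans hM.le)
        (a := 2 * ‖V‖) (by positivity)
      refine div_le_div_of_nonneg_right (add_le_add le_rfl ?_) (by linarith)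
      set E := Real.exp (-lam * (M - 2 * p - 18 * ‖V‖))
      calc _ ≤ (M + 5 * ‖V‖ + q) * (2 * √2 * E) :=
            mul_le_mul_of_nonneg_right (by linarith) (by positivity)
        _ = 2 * √2 * (M + 5 * ‖V‖ + q) * E := by ring
  · intro ε δ hε hεδ
    have hδ : 0 < δ := hε.trans_lt hεδ
    have hκ : ‖specProj K (Set.Ici M) * specProj (V + truncate K M) (Set.Icc (-ε) ε)‖ ≤
        2 * √2 * Real.exp (-lam * (M - 2 * ε - 10 * ‖V‖)) := by
      rw [← specProj_mul_of_subset _ (Set.Icc_subset_Iic_self (a := -ε) (b := ε)), ← mul_assoc]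
      refine (norm_mul_le _ _).trans ((mul_le_of_le_one_right (norm_nonneg _)
        (norm_specProj_le_one _ _)).trans ((htail ε).trans
          (exp_neg_mul_le_two_mul_sqrt_two_mul_exp hlam (by linarith))))
    refine (norm_specProj_compl_mul_le (a := 0) (hV.add hK) hK hKM hδ (fun x _ hx => ?_)
      (norm_add_algebraMap_mul_specProj_le (hV.add hT) hε fun x _ hx => ?_) hκ).trans ?_
    · rw [add_zero]
      exact not_lt.1 fun h => hx (abs_lt.1 h)
    · rw [add_zero]
      exact abs_le.2 hx
    · have hG := norm_add_truncate_add_algebraMap_le V hK hKM (h0.trans hM.le) le_rfl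
      refine div_le_div_of_nonneg_right (add_le_add le_rfl ?_) hδ.le
      set E := Real.exp (-lam * (M - 2 * ε - 10 * ‖V‖))
      calc _ ≤ (M + ‖V‖ + δ) * (2 * √2 * E) := by
            gcongr
            linarith
        _ = 2 * √2 * (M + ‖V‖ + δ) * E := by ring
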